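/- Let $k$ be a field and let $\Lambda$ be a finite dimensional Hopf algebra over $k$, with comultiplication $\Delta$, counit $\varepsilon$ and antipode $S$. Assume that $\Lambda$ is split (the endomorphism algebra of each simple left $\Lambda$-module is isomorphic to $k$) and basic (each simple left $\Lambda$-module has multiplicity one in the maximal semisimple quotient $\Lambda/\operatorname{rad}\Lambda$), and that $\Lambda$ is not semisimple. Recall that all simple left $\Lambda$-modules are then one-dimensional and that the set $\mathcal S$ of their isomorphism classes is a group, the structure group of $\Lambda$: the product of $[M]$ and $[N]$ is $[M\otimes_k N]$, where $\Lambda$ acts through $\Delta$, the unit is the class of the trivial module $k_\varepsilon$ ($k$ with $\Lambda$ acting through $\varepsilon$), and the inverse of $[M]$ is the class of the dual $M^*=\operatorname{Hom}_k(M,k)$, with $(af)(m)=f(S(a)m)$. Let $P_1$ be the projective cover of $k_\varepsilon$, and let the canonical element $c\in\mathbf Z\mathcal S$ be the sum of the classes of the factors of a composition series of $P_1$; that is, $c=\sum_{T\in\mathcal S}[P_1:T]\,T$, where $[P_1:T]$ is the multiplicity of $T$ as a composition factor of $P_1$. Then $c$ lies in the center of the integral group ring $\mathbf Z\mathcal S$.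 -/

import Mathlib

open scoped TensorProduct

universe u

set_option linter.unusedSectionVars false

noncomputable section

namespace HopfRep

section Algebras

/-- A ring is basic if each simple (left) module has multiplicity one in the maximal semisimple
quotient `Λ / rad Λ`, i.e. the sum of all submodules of `Λ / rad Λ` isomorphic to a given simple
module is itself simple. -/
class IsBasic (Λ : Type u) [Ring Λ] : Prop where
  isotypic_simple : ∀ (S : Type u) [AddCommGroup S] [Module Λ S] [IsSimpleModule Λ S],
    IsSimpleModule Λ (isotypicComponent Λ (Λ ⧸ Ring.jacobson Λ) S)

/-- An algebra is split if the endomorphism ring of each simple module is isomorphic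
to the ground field. -/
class IsSplit (k Λ : Type u) [Field k] [Ring Λ] [Algebra k Λ] : Prop where
  end_simple : ∀ (S : Type u) [AddCommGroup S] [Module k S] [Module Λ S] [IsScalarTower k Λ S]
    [IsSimpleModule Λ S], Nonempty (Module.End Λ S ≃ₐ[k] k)

/-- A surjection `ψ : P → M` from a projective module is a projective cover if it is essential:
the restriction of `ψ` to a proper submodule is never surjective. -/
structure IsProjectiveCover {Λ P M : Type u} [Ring Λ] [AddCommGroup P] [Module Λ P]
    [AddCommGroup M] [Module Λ M] (ψ : P →ₗ[Λ] M) : Prop where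
  projective : Module.Projective Λ P
  surjective : Function.Surjective ψ
  essential : ∀ X : Submodule Λ P, X.map ψ = ⊤ → X = ⊤

end Algebras

variable (k Λ : Type u) [Field k] [Ring Λ]

/-- A (bundled) left module over a `k`-algebra `Λ`. -/
structure BundledModule [Algebra k Λ] where
  carrier : Type u
  [addCommGroup : AddCommGroup carrier]
  [moduleField : Module k carrier]
  [module : Module Λ carrier]
  [tower : IsScalarTower k Λ carrier]

attribute [instance] BundledModule.addCommGroup BundledModule.moduleField
  BundledModule.module BundledModule.tower

instance [Algebra k Λ] : CoeSort (BundledModule k Λ) (Type u) := ⟨BundledModule.carrier⟩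

section HopfModules

variable [HopfAlgebra k Λ]

/-- The trivial module: the ground field on which `Λ` acts through the counit. -/
def Triv (_k _Λ : Type u) : Type u := _k

instance : AddCommGroup (Triv k Λ) := inferInstanceAs (AddCommGroup k)
instance : Module k (Triv k Λ) := inferInstanceAs (Module k k)
instance : Module Λ (Triv k Λ) :=
  Module.compHom (Triv k Λ) (Bialgebra.counitAlgHom k Λ).toRingHom

variable {k Λ} in
theorem Triv.smul_def (a : Λ) (x : Triv k Λ) :
    a • x = (Coalgebra.counit (R := k) a : k) • x := rfl

instance : IsScalarTower k Λ (Triv k Λ) where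
  smul_assoc c a x := by
    simp [Triv.smul_def, mul_smul]

variable (M N : Type u) [AddCommGroup M] [Module k M] [Module Λ M] [IsScalarTower k Λ M]
  [AddCommGroup N] [Module k N] [Module Λ N] [IsScalarTower k Λ N]

/-- The action of `Λ` on `M ⊗ N` through the comultiplication. -/
def tensorAction : Λ →ₐ[k] Module.End k (M ⊗[k] N) :=
  (Module.endTensorEndAlgHom (R := k) (S := k) (A := k) (M := M) (N := N)).comp
    ((Algebra.TensorProduct.map (Algebra.lsmul k k M : Λ →ₐ[k] Module.End k M)
      (Algebra.lsmul k k N : Λ →ₐ[k] Module.End k N)).comp (Bialgebra.comulAlgHom k Λ))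

/-- The tensor product over `k` of two `Λ`-modules, with `Λ` acting through `Δ`. -/
def HTensor (k Λ M N : Type u) [Field k] [Ring Λ] [HopfAlgebra k Λ]
    [AddCommGroup M] [Module k M] [Module Λ M] [IsScalarTower k Λ M]
    [AddCommGroup N] [Module k N] [Module Λ N] [IsScalarTower k Λ N] : Type u := M ⊗[k] N

instance : AddCommGroup (HTensor k Λ M N) := inferInstanceAs (AddCommGroup (M ⊗[k] N))
instance : Module k (HTensor k Λ M N) := inferInstanceAs (Module k (M ⊗[k] N))

/-- The identity `M ⊗ N = M ⊗[k] N`, as vector spaces. -/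
def HTensor.toTensor : HTensor k Λ M N ≃ₗ[k] M ⊗[k] N := LinearEquiv.refl k (M ⊗[k] N)

instance : Module Λ (HTensor k Λ M N) where
  smul a x := (HTensor.toTensor k Λ M N).symm
    (tensorAction k Λ M N a (HTensor.toTensor k Λ M N x))
  one_smul x := by
    change (HTensor.toTensor k Λ M N).symm
      (tensorAction k Λ M N 1 (HTensor.toTensor k Λ M N x)) = x
    simp
  mul_smul a b x := by
    change (HTensor.toTensor k Λ M N).symm
      (tensorAction k Λ M N (a * b) (HTensor.toTensor k Λ M N x)) =
      (HTensor.toTensor k Λ M N).symm (tensorAction k Λ M N a (HTensor.toTensor k Λ M N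
        ((HTensor.toTensor k Λ M N).symm
          (tensorAction k Λ M N b (HTensor.toTensor k Λ M N x)))))
    simp
  smul_zero a := by
    change (HTensor.toTensor k Λ M N).symm
      (tensorAction k Λ M N a (HTensor.toTensor k Λ M N 0)) = 0
    simp
  smul_add a x y := by
    change (HTensor.toTensor k Λ M N).symm
      (tensorAction k Λ M N a (HTensor.toTensor k Λ M N (x + y))) =
      (HTensor.toTensor k Λ M N).symm (tensorAction k Λ M N a (HTensor.toTensor k Λ M N x)) +
      (HTensor.toTensor k Λ M N).symm (tensorAction k Λ M N a (HTensor.toTensor k Λ M N y))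
    simp
  add_smul a b x := by
    change (HTensor.toTensor k Λ M N).symm
      (tensorAction k Λ M N (a + b) (HTensor.toTensor k Λ M N x)) =
      (HTensor.toTensor k Λ M N).symm (tensorAction k Λ M N a (HTensor.toTensor k Λ M N x)) +
      (HTensor.toTensor k Λ M N).symm (tensorAction k Λ M N b (HTensor.toTensor k Λ M N x))
    simp
  zero_smul x := by
    change (HTensor.toTensor k Λ M N).symm
      (tensorAction k Λ M N 0 (HTensor.toTensor k Λ M N x)) = 0
    simp

variable {k Λ M N} in
theorem HTensor.toTensor_smul (a : Λ) (x : HTensor k Λ M N) :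
    HTensor.toTensor k Λ M N (a • x) =
      tensorAction k Λ M N a (HTensor.toTensor k Λ M N x) := rfl

instance : IsScalarTower k Λ (HTensor k Λ M N) where
  smul_assoc c a x := by
    apply (HTensor.toTensor k Λ M N).injective
    rw [LinearEquiv.map_smul, HTensor.toTensor_smul, HTensor.toTensor_smul, map_smul,
      LinearMap.smul_apply]

/-- The dual `Hom_k(M, k)`, with `Λ` acting by `(a • f) m = f (S(a) m)`, `S` the antipode. -/
def HDual (k Λ M : Type u) [Field k] [Ring Λ] [HopfAlgebra k Λ]
    [AddCommGroup M] [Module k M] [Module Λ M] [IsScalarTower k Λ M] : Type u := Module.Dual k M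

instance : AddCommGroup (HDual k Λ M) := inferInstanceAs (AddCommGroup (Module.Dual k M))
instance : Module k (HDual k Λ M) := inferInstanceAs (Module k (Module.Dual k M))


/-- The identity `M^* = Hom_k(M, k)`, as vector spaces. -/
def HDual.toDual : HDual k Λ M ≃ₗ[k] Module.Dual k M := LinearEquiv.refl k (Module.Dual k M)

instance : SMul Λ (HDual k Λ M) where
  smul a f := (HDual.toDual k Λ M).symm
    (HDual.toDual k Λ M f ∘ₗ Algebra.lsmul k k M (HopfAlgebra.antipode k a))

variable {k Λ M} in
theorem HDual.toDual_smul_apply (a : Λ) (f : HDual k Λ M) (m : M) :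
    HDual.toDual k Λ M (a • f) m = HDual.toDual k Λ M f (HopfAlgebra.antipode k a • m) := rfl

instance : Module Λ (HDual k Λ M) where
  one_smul f := (HDual.toDual k Λ M).injective <| LinearMap.ext fun m => by
    simp [HDual.toDual_smul_apply]
  mul_smul a b f := (HDual.toDual k Λ M).injective <| LinearMap.ext fun m => by
    simp [HDual.toDual_smul_apply, HopfAlgebra.antipode_mul_antidistrib, mul_smul]
  smul_zero a := (HDual.toDual k Λ M).injective <| LinearMap.ext fun m => by
    simp [HDual.toDual_smul_apply]
  smul_add a f g := (HDual.toDual k Λ M).injective <| LinearMap.ext fun m => by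
    simp [HDual.toDual_smul_apply]
  add_smul a b f := (HDual.toDual k Λ M).injective <| LinearMap.ext fun m => by
    simp [HDual.toDual_smul_apply, add_smul]
  zero_smul f := (HDual.toDual k Λ M).injective <| LinearMap.ext fun m => by
    simp [HDual.toDual_smul_apply]

instance : IsScalarTower k Λ (HDual k Λ M) where
  smul_assoc c a f := (HDual.toDual k Λ M).injective <| LinearMap.ext fun m => by
    simp [HDual.toDual_smul_apply]

end HopfModules

section Characters

variable [Algebra k Λ]

variable {k Λ} in
/-- `Λ` acts on `M` through scalars, given by `χ`. -/
def HasChar (M : Type u) [AddCommGroup M] [Module k M] [Module Λ M] (χ : Λ →ₗ[k] k) : Prop :=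
  ∀ (a : Λ) (m : M), a • m = χ a • m

variable {k Λ}
variable {M N : Type u} [AddCommGroup M] [Module k M] [Module Λ M] [IsScalarTower k Λ M]
  [AddCommGroup N] [Module k N] [Module Λ N] [IsScalarTower k Λ N]

theorem exists_hasChar (h : Module.finrank k M = 1) : ∃ χ : Λ →ₗ[k] k, HasChar M χ := by
  obtain ⟨v, hv, hs⟩ := finrank_eq_one_iff'.mp h
  choose c hc using hs
  have inj : ∀ x y : k, x • v = y • v → x = y := fun x y hxy => smul_left_injective k hv hxy
  refine ⟨{ toFun := fun a => c (a • v), map_add' := fun a b => inj _ _ ?_,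
            map_smul' := fun r a => inj _ _ ?_ }, fun a m => ?_⟩
  · rw [hc, add_smul, add_smul, hc, hc]
  · rw [hc, smul_assoc, RingHom.id_apply, smul_assoc, hc]
  · obtain ⟨r, rfl⟩ : ∃ r : k, r • v = m := ⟨c m, hc m⟩
    change a • r • v = c (a • v) • r • v
    rw [smul_comm (c (a • v)) r v, hc, smul_comm]

theorem nonempty_equiv_of_hasChar (hM : Module.finrank k M = 1) (hN : Module.finrank k N = 1)
    {χ : Λ →ₗ[k] k} (h₁ : HasChar M χ) (h₂ : HasChar N χ) : Nonempty (M ≃ₗ[Λ] N) := by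
  have : Module.Finite k M := Module.finite_of_finrank_eq_succ hM
  have : Module.Finite k N := Module.finite_of_finrank_eq_succ hN
  let e : M ≃ₗ[k] N := LinearEquiv.ofFinrankEq M N (hM.trans hN.symm)
  exact ⟨{ e with map_smul' := fun a m => show e (a • m) = a • e m by rw [h₁, h₂, map_smul] }⟩

theorem HasChar.of_equiv {χ : Λ →ₗ[k] k} (h : HasChar M χ) (e : M ≃ₗ[Λ] N) : HasChar N χ := by
  intro a n
  obtain ⟨m, rfl⟩ := e.surjective n
  have := (e : M →ₗ[Λ] N).restrictScalars k |>.map_smul (χ a) m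
  change e (χ a • m) = χ a • e m at this
  rw [← map_smul, h, this]

theorem HasChar.map_mul [Nontrivial M] {χ : Λ →ₗ[k] k} (h : HasChar M χ) (a b : Λ) :
    χ (a * b) = χ a * χ b := by
  obtain ⟨v, hv⟩ := exists_ne (0 : M)
  refine smul_left_injective k hv ?_
  change χ (a * b) • v = (χ a * χ b) • v
  rw [← h, mul_smul, h b, h a, smul_smul]

theorem HasChar.map_one [Nontrivial M] {χ : Λ →ₗ[k] k} (h : HasChar M χ) : χ 1 = 1 := by
  obtain ⟨v, hv⟩ := exists_ne (0 : M)
  refine smul_left_injective k hv ?_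
  change χ 1 • v = (1 : k) • v
  rw [← h, one_smul, one_smul]

theorem isSimpleModule_of_finrank (h : Module.finrank k M = 1) : IsSimpleModule Λ M := by
  have hs := (isSimpleModule_iff_finrank_eq_one (R := k) (M := M)).mpr h
  have : Nontrivial M := IsSimpleModule.nontrivial k M
  refine { exists_pair_ne := exists_pair_ne _, eq_bot_or_eq_top := fun X => ?_ }
  rcases eq_bot_or_eq_top (X.restrictScalars k) with h | h
  · exact Or.inl ((Submodule.restrictScalars_eq_bot_iff ..).mp h)
  · exact Or.inr ((Submodule.restrictScalars_eq_top_iff ..).mp h)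

end Characters

section OneDim

variable [Algebra k Λ] [Module.Finite k Λ] [IsBasic Λ] [IsSplit k Λ]

/-- Over a basic and split finite dimensional algebra, simple modules are one-dimensional. -/
theorem finrank_simple (S : Type u) [AddCommGroup S] [Module k S] [Module Λ S]
    [IsScalarTower k Λ S] [IsSimpleModule Λ S] : Module.finrank k S = 1 := by
  have : IsArtinianRing Λ := IsArtinianRing.of_finite k Λ
  let J : Submodule Λ Λ := Ring.jacobson Λ
  have ss : IsSemisimpleModule Λ (Λ ⧸ J) :=
    (IsArtinian.isSemisimpleModule_iff_jacobson Λ (Λ ⧸ J)).mpr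
      (Module.jacobson_quotient_jacobson Λ Λ)
  let I : Submodule Λ (Λ ⧸ J) := isotypicComponent Λ (Λ ⧸ J) S
  have hI : IsSimpleModule Λ I := IsBasic.isotypic_simple S
  obtain ⟨ε⟩ := IsSplit.end_simple (k := k) (Λ := Λ) S
  have key : ∀ f : (Λ ⧸ J) →ₗ[Λ] S, f ∘ₗ I.subtype = 0 → f = 0 := by
    intro f hf
    by_contra hne
    have hs : Function.Surjective f := LinearMap.surjective_of_ne_zero hne
    obtain ⟨C, hC⟩ := exists_isCompl (LinearMap.ker f)
    have hCI : C ≤ I := le_sSup ⟨(Submodule.quotientEquivOfIsCompl _ C hC).symm.trans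
      (f.quotKerEquivOfSurjective hs)⟩
    have hIk : I ≤ LinearMap.ker f := fun x hx => LinearMap.congr_fun hf ⟨x, hx⟩
    have hCb : C = ⊥ := by
      have := hC.disjoint.eq_bot
      rwa [inf_eq_right.mpr (hCI.trans hIk)] at this
    have htop := hC.sup_eq_top
    rw [hCb, sup_bot_eq] at htop
    exact hne (LinearMap.ker_eq_top.mp htop)
  let φ : S → ((Λ ⧸ J) →ₗ[Λ] S) := fun s => J.liftQ (LinearMap.toSpanSingleton Λ S s)
    (IsSemisimpleModule.jacobson_le_ker Λ Λ Λ S _)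
  have φ_one : ∀ s, φ s (J.mkQ 1) = s := fun s =>
    (J.liftQ_apply _ 1).trans (one_smul Λ s)
  have : Nontrivial S := IsSimpleModule.nontrivial Λ S
  obtain ⟨v, hv⟩ := exists_ne (0 : S)
  have hg : φ v ∘ₗ I.subtype ≠ 0 := fun h => hv <| by
    rw [← φ_one v, key _ h, LinearMap.zero_apply]
  let e : I ≃ₗ[Λ] S := LinearEquiv.ofBijective _ (LinearMap.bijective_of_ne_zero hg)
  refine finrank_eq_one_iff'.mpr ⟨v, hv, fun w => ?_⟩
  let h : Module.End Λ S := (φ w ∘ₗ I.subtype) ∘ₗ (e.symm : S →ₗ[Λ] I)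
  have hh : h = algebraMap k (Module.End Λ S) (ε h) := by
    rw [← ε.symm.commutes, Algebra.algebraMap_self, RingHom.id_apply, ε.symm_apply_apply]
  have hz : φ w - (algebraMap k (Module.End Λ S) (ε h)) ∘ₗ φ v = 0 := by
    apply key
    rw [← hh]
    ext i
    have hi : e.symm (φ v i) = i := e.symm_apply_apply i
    simp [h, hi]
  refine ⟨ε h, ?_⟩
  have := LinearMap.congr_fun hz (J.mkQ 1)
  rw [LinearMap.sub_apply, LinearMap.comp_apply, φ_one, φ_one, LinearMap.zero_apply,
    sub_eq_zero] at this
  exact this.symm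

end OneDim

section StructureGroup

/-- Two modules are isomorphic. -/
instance simpleSetoid [Algebra k Λ] : Setoid {M : BundledModule k Λ // IsSimpleModule Λ M} where
  r M N := Nonempty (M.1 ≃ₗ[Λ] N.1)
  iseqv := ⟨fun _ => ⟨.refl _ _⟩, fun ⟨e⟩ => ⟨e.symm⟩, fun ⟨e⟩ ⟨f⟩ => ⟨e.trans f⟩⟩

/-- The set of isomorphism classes of simple `Λ`-modules. -/
def StructureGroup [Algebra k Λ] : Type (u + 1) := Quotient (simpleSetoid k Λ)

variable {Λ} in
/-- The isomorphism class of a simple module. -/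
def simpleClass [Algebra k Λ] (M : Type u) [AddCommGroup M] [Module k M] [Module Λ M]
    [IsScalarTower k Λ M] (h : IsSimpleModule Λ M) : StructureGroup k Λ :=
  Quotient.mk (simpleSetoid k Λ) ⟨⟨M⟩, h⟩

variable [HopfAlgebra k Λ]

section

variable {k Λ}
variable {M N : Type u} [AddCommGroup M] [Module k M] [Module Λ M] [IsScalarTower k Λ M]
  [AddCommGroup N] [Module k N] [Module Λ N] [IsScalarTower k Λ N]

theorem finrank_triv : Module.finrank k (Triv k Λ) = 1 := Module.finrank_self k

theorem finrank_tensor (hM : Module.finrank k M = 1) (hN : Module.finrank k N = 1) :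
    Module.finrank k (HTensor k Λ M N) = 1 := by
  rw [(HTensor.toTensor k Λ M N).finrank_eq, Module.finrank_tensorProduct, hM, hN]

theorem finrank_dual (hM : Module.finrank k M = 1) : Module.finrank k (HDual k Λ M) = 1 := by
  rw [(HDual.toDual k Λ M).finrank_eq, Subspace.dual_finrank_eq, hM]

theorem hasChar_triv : HasChar (Λ := Λ) (Triv k Λ) (Coalgebra.counit (R := k) (A := Λ)) :=
  Triv.smul_def

theorem hasChar_dual {χ : Λ →ₗ[k] k} (h : HasChar M χ) :
    HasChar (HDual k Λ M) (χ ∘ₗ HopfAlgebra.antipode k) := fun a f =>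
  (HDual.toDual k Λ M).injective <| LinearMap.ext fun m => by
    simp [HDual.toDual_smul_apply, h _ m]

open WithConv in
theorem hasChar_tensor {χ ψ : Λ →ₗ[k] k} (h : HasChar M χ) (h' : HasChar N ψ) :
    HasChar (HTensor k Λ M N) (toConv χ * toConv ψ).ofConv := fun a x => by
  apply (HTensor.toTensor k Λ M N).injective
  rw [HTensor.toTensor_smul, LinearEquiv.map_smul]
  generalize HTensor.toTensor k Λ M N x = y
  have hr := (Coalgebra.Repr.arbitrary k a).convMul_apply (toConv χ) (toConv ψ)
  change (toConv χ * toConv ψ).ofConv a = _ at hr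
  rw [hr]
  induction y with
  | zero => simp
  | add y z hy hz => rw [map_add, hy, hz, smul_add]
  | tmul m n =>
    simp only [tensorAction, AlgHom.comp_apply, Bialgebra.comulAlgHom_apply]
    rw [← (Coalgebra.Repr.arbitrary k a).eq]
    simp only [map_sum, LinearMap.sum_apply, Finset.sum_smul]
    refine Finset.sum_congr rfl fun i _ => ?_
    rw [← TensorProduct.smul_tmul_smul, ← h, ← h']
    rfl

end

variable [Module.Finite k Λ] [IsBasic Λ] [IsSplit k Λ]

variable {Λ} in
theorem simple_finrank (M : {M : BundledModule k Λ // IsSimpleModule Λ M}) : Module.finrank k M.1 = 1 :=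
  have := M.2
  finrank_simple k Λ M.1

variable {Λ} in
theorem simple_hasChar (M : {M : BundledModule k Λ // IsSimpleModule Λ M}) :
    ∃ χ : Λ →ₗ[k] k, HasChar M.1 χ := exists_hasChar (simple_finrank k M)

instance : One (StructureGroup k Λ) where
  one := simpleClass k (Triv k Λ) (isSimpleModule_of_finrank (k := k) finrank_triv)

instance : Mul (StructureGroup k Λ) where
  mul := Quotient.map₂
    (fun M N => ⟨⟨HTensor k Λ M.1 N.1⟩, isSimpleModule_of_finrank (k := k)
      (finrank_tensor (simple_finrank k M) (simple_finrank k N))⟩) (by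
    rintro M M' ⟨e⟩ N N' ⟨f⟩
    obtain ⟨χ, hχ⟩ := simple_hasChar k M
    obtain ⟨ψ, hψ⟩ := simple_hasChar k N
    exact nonempty_equiv_of_hasChar (k := k)
      (finrank_tensor (simple_finrank k M) (simple_finrank k N))
      (finrank_tensor (simple_finrank k M') (simple_finrank k N'))
      (hasChar_tensor hχ hψ) (hasChar_tensor (hχ.of_equiv e) (hψ.of_equiv f)))

instance : Inv (StructureGroup k Λ) where
  inv := Quotient.map
    (fun M => ⟨⟨HDual k Λ M.1⟩, isSimpleModule_of_finrank (k := k)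
      (finrank_dual (simple_finrank k M))⟩) (by
    rintro M M' ⟨e⟩
    obtain ⟨χ, hχ⟩ := simple_hasChar k M
    exact nonempty_equiv_of_hasChar (k := k)
      (finrank_dual (simple_finrank k M)) (finrank_dual (simple_finrank k M'))
      (hasChar_dual hχ) (hasChar_dual (hχ.of_equiv e)))

open WithConv in
/-- The group structure on the set of isomorphism classes of simple modules: the product is the
tensor product over `k`, the unit is the trivial module, and the inverse is the dual. -/
instance : Group (StructureGroup k Λ) :=
  Group.ofLeftAxioms
    (by
      rintro ⟨L⟩ ⟨M⟩ ⟨N⟩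
      obtain ⟨χ, hχ⟩ := simple_hasChar k L
      obtain ⟨ψ, hψ⟩ := simple_hasChar k M
      obtain ⟨ω, hω⟩ := simple_hasChar k N
      have hL := simple_finrank k L
      have hM := simple_finrank k M
      have hN := simple_finrank k N
      refine Quotient.sound (nonempty_equiv_of_hasChar (k := k)
        (finrank_tensor (finrank_tensor hL hM) hN) (finrank_tensor hL (finrank_tensor hM hN))
        (hasChar_tensor (hasChar_tensor hχ hψ) hω) ?_)
      have := hasChar_tensor hχ (hasChar_tensor hψ hω)
      simpa only [toConv_ofConv, mul_assoc] using this)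
    (by
      rintro ⟨M⟩
      obtain ⟨χ, hχ⟩ := simple_hasChar k M
      have hM := simple_finrank k M
      refine Quotient.sound (nonempty_equiv_of_hasChar (k := k)
        (finrank_tensor finrank_triv hM) hM (hasChar_tensor hasChar_triv hχ) ?_)
      have h1 : toConv (Coalgebra.counit (R := k) (A := Λ)) = 1 := rfl
      rw [h1, one_mul]
      exact hχ)
    (by
      rintro ⟨M⟩
      obtain ⟨χ, hχ⟩ := simple_hasChar k M
      have hM := simple_finrank k M
      have := M.2
      have : Nontrivial M.1 := IsSimpleModule.nontrivial Λ _
      refine Quotient.sound (nonempty_equiv_of_hasChar (k := k)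
        (finrank_tensor (finrank_dual hM) hM) finrank_triv
        (hasChar_tensor (hasChar_dual hχ) hχ) ?_)
      have h1 : (toConv (χ ∘ₗ HopfAlgebra.antipode k) * toConv χ).ofConv =
          Coalgebra.counit (R := k) (A := Λ) := by
        ext a
        have hr := (Coalgebra.Repr.arbitrary k a).convMul_apply
          (toConv (χ ∘ₗ HopfAlgebra.antipode k)) (toConv χ)
        refine hr.trans ?_
        have hs := congrArg χ
          (HopfAlgebra.sum_antipode_mul_eq_smul (Coalgebra.Repr.arbitrary k a))
        rw [map_sum, map_smul, hχ.map_one, smul_eq_mul, mul_one] at hs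
        rw [← hs]
        exact Finset.sum_congr rfl fun i _ => (hχ.map_mul _ _).symm
      rw [h1]
      exact hasChar_triv)

end StructureGroup

section DimensionVector

variable {k Λ} [Algebra k Λ] {M : Type u} [AddCommGroup M] [Module k M] [Module Λ M]
  [IsScalarTower k Λ M]

variable (k) in
/-- The class of the simple module `B / A`, for `A ⋖ B` consecutive submodules. -/
def factorClass (A B : Submodule Λ M) (h : A ⋖ B) : StructureGroup k Λ :=
  have hs : IsSimpleModule Λ (B ⧸ A.submoduleOf B) := (covBy_iff_quot_is_simple h.le).mp h
  simpleClass k (B ⧸ A.submoduleOf B) hs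

/-- The sum of the classes of the factors of a composition series, in the free abelian group
on the set of isomorphism classes of simple modules, written as a group ring. -/
def compositionSum (s : CompositionSeries (Submodule Λ M)) :
    MonoidAlgebra ℤ (StructureGroup k Λ) :=
  ∑ i : Fin s.length,
    MonoidAlgebra.single (factorClass k (s i.castSucc) (s i.succ) (s.step i)) 1

variable (k Λ M) in
/-- The dimension vector of a module of finite length: the sum of the classes of the factors of one
of its composition series. -/
def dimensionVector [IsNoetherian Λ M] [IsArtinian Λ M] : MonoidAlgebra ℤ (StructureGroup k Λ) :=
  compositionSum (exists_compositionSeries_of_isNoetherian_isArtinian Λ M).choose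

end DimensionVector

section CanonicalElement

variable [HopfAlgebra k Λ] [Module.Finite k Λ]

variable {k Λ} in
theorem exists_projectiveCover_aux {S : Type u} [AddCommGroup S] [Module Λ S] (n : ℕ) :
    ∀ P : BundledModule k Λ, Module.finrank k P = n → Module.Finite Λ P → Module.Projective Λ P →
      ∀ ψ : P →ₗ[Λ] S, Function.Surjective ψ →
      ∃ Q : BundledModule k Λ, Module.Finite Λ Q ∧ ∃ φ : Q →ₗ[Λ] S, IsProjectiveCover φ := by
  induction n using Nat.strong_induction_on with
  | _ n ih =>
  intro P hn hf hp ψ hψ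
  by_cases hess : ∀ X : Submodule Λ P, X.map ψ = ⊤ → X = ⊤
  · exact ⟨P, hf, ψ, hp, hψ, hess⟩
  push Not at hess
  obtain ⟨X, hX, hXne⟩ := hess
  have : IsArtinianRing Λ := IsArtinianRing.of_finite k Λ
  have : Module.Finite k P := Module.Finite.trans Λ P
  have hsurj : Function.Surjective (ψ ∘ₗ X.subtype) := by
    rw [← LinearMap.range_eq_top, LinearMap.range_comp, Submodule.range_subtype, hX]
  obtain ⟨g, hg⟩ := Module.projective_lifting_property (ψ ∘ₗ X.subtype) ψ hsurj
  let f : Module.End Λ P := X.subtype ∘ₗ g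
  have hf1 : ψ ∘ₗ f = ψ := hg
  have hfn : ∀ m : ℕ, ψ ∘ₗ (f ^ m) = ψ := by
    intro m
    induction m with
    | zero => rfl
    | succ m ih => rw [pow_succ, Module.End.mul_eq_comp, ← LinearMap.comp_assoc, ih, hf1]
  obtain ⟨m, hm, hm1⟩ :=
    (f.eventually_isCompl_ker_pow_range_pow.and (Filter.eventually_ge_atTop 1)).exists
  let Q : Submodule Λ P := LinearMap.range (f ^ m)
  have hQX : Q ≤ X := by
    rintro _ ⟨x, rfl⟩
    obtain ⟨j, rfl⟩ := Nat.exists_eq_add_of_le' hm1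
    rw [pow_succ']
    exact (g ((f ^ j) x)).2
  have hlt : Module.finrank k Q < n := by
    rw [← hn]
    refine Submodule.finrank_lt (s := Q.restrictScalars k) fun h => hXne ?_
    exact top_le_iff.mp (((Submodule.restrictScalars_eq_top_iff ..).mp h).ge.trans hQX)
  refine ih _ hlt ⟨Q⟩ rfl (inferInstanceAs (Module.Finite Λ Q)) ?_ (ψ ∘ₗ Q.subtype) ?_
  · refine Module.Projective.of_split Q.subtype (Q.projectionOnto _ hm.symm) ?_
    ext x
    simp
  · intro s
    obtain ⟨x, hx⟩ := hψ s
    refine ⟨⟨(f ^ m) x, x, rfl⟩, ?_⟩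
    rw [← hx]
    exact LinearMap.congr_fun (hfn m) x

theorem exists_projectiveCover_triv : ∃ P : BundledModule k Λ, Module.Finite Λ P ∧
    ∃ ψ : P →ₗ[Λ] Triv k Λ, IsProjectiveCover ψ :=
  exists_projectiveCover_aux _ ⟨Λ⟩ rfl (inferInstanceAs (Module.Finite Λ Λ))
    (inferInstanceAs (Module.Projective Λ Λ)) (LinearMap.toSpanSingleton Λ (Triv k Λ) (1 : k))
    fun c => ⟨algebraMap k Λ c, by
      have h : ∀ (c : k) (x : Triv k Λ), algebraMap k Λ c • x = c • x :=
        fun c x => algebraMap_smul Λ c x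
      exact (h c (1 : k)).trans (@mul_one k _ c)⟩

/-- The projective cover `P₁` of the trivial module (unique up to isomorphism). -/
def P₁ : BundledModule k Λ := (exists_projectiveCover_triv k Λ).choose

instance : Module.Finite Λ (P₁ k Λ) := (exists_projectiveCover_triv k Λ).choose_spec.1

theorem P₁_spec : ∃ ψ : P₁ k Λ →ₗ[Λ] Triv k Λ, IsProjectiveCover ψ :=
  (exists_projectiveCover_triv k Λ).choose_spec.2

instance : IsNoetherian Λ (P₁ k Λ) :=
  have := IsArtinianRing.of_finite k Λ
  inferInstance

instance : IsArtinian Λ (P₁ k Λ) :=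
  have := IsArtinianRing.of_finite k Λ
  inferInstance

/-- The canonical element `c`: the dimension vector of the projective cover of the trivial
module. -/
def canonicalElement : MonoidAlgebra ℤ (StructureGroup k Λ) := dimensionVector k Λ (P₁ k Λ)

end CanonicalElement

end HopfRep

end

/-! The group elements span the integral group ring, so it suffices that `c` commutes with each
class `T`. Let `χ` be the character through which `Λ` acts on `T`, and `χ'` its convolution inverse,
the character of `T⁻¹`. The twist `σ(a) = ∑ χ(a₁) a₂ χ'(a₃)` is a surjective algebra endomorphism of
`Λ`, and `ψ ∘ σ = χ * ψ * χ'` for every character `ψ`. Restriction along `σ` therefore conjugates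
simple classes by `T`, and it fixes the trivial class because `χ * ε * χ' = ε`. Since `σ` preserves
the counit, projectivity and essentiality of the cover produce a bijective `σ`-semilinear map `g :
P₁ → P₁` (`IsProjectiveCover.exists_semilinear`). It carries a composition series `s` to another
one, `t`, and the factor of `s` at each place is the `T`-conjugate of the factor of `t` there
(`factorClass_map`). By Jordan–Hölder both series have the same sum `c`, whence `c = T c T⁻¹`. -/

open WithConv

noncomputable section

namespace HopfRep

/-! ### Twists by characters, computed in the convolution algebra -/

section Twist

variable {k Λ : Type*} [Field k] [Ring Λ] [Bialgebra k Λ]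

/-- The algebra endomorphism `a ↦ ∑ χ(a₁) a₂` attached to a character `χ`. -/
def leftTwist (χ : Λ →ₐ[k] k) : Λ →ₐ[k] Λ :=
  (Algebra.TensorProduct.lift ((Algebra.ofId k Λ).comp χ) (AlgHom.id k Λ)
    fun _ _ => Algebra.commutes _ _).comp (Bialgebra.comulAlgHom k Λ)

/-- The algebra endomorphism `a ↦ ∑ a₁ χ(a₂)` attached to a character `χ`. -/
def rightTwist (χ : Λ →ₐ[k] k) : Λ →ₐ[k] Λ :=
  (Algebra.TensorProduct.lift (AlgHom.id k Λ) ((Algebra.ofId k Λ).comp χ)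
    fun _ _ => (Algebra.commutes _ _).symm).comp (Bialgebra.comulAlgHom k Λ)

/-- A character of `Λ`, followed by the unit map of `B`, in the convolution algebra. -/
def convChar (B : Type*) [Ring B] [Algebra k B] (χ : Λ →ₐ[k] k) : WithConv (Λ →ₗ[k] B) :=
  toConv ((Algebra.ofId k B).comp χ).toLinearMap

/-- A twist becomes multiplication by a character in the convolution algebra, so composites of
twists reduce to associativity there. -/
theorem toConv_leftTwist (χ : Λ →ₐ[k] k) :
    toConv (leftTwist χ).toLinearMap = convChar Λ χ * toConv (AlgHom.id k Λ).toLinearMap := by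
  ext a
  have hr := (Coalgebra.Repr.arbitrary k a).convMul_apply
    (convChar Λ χ) (toConv (AlgHom.id k Λ).toLinearMap)
  refine Eq.trans ?_ hr.symm
  change leftTwist χ a = _
  rw [leftTwist, AlgHom.comp_apply, Bialgebra.comulAlgHom_apply,
    ← (Coalgebra.Repr.arbitrary k a).eq]
  rw [map_sum]
  exact Finset.sum_congr rfl fun i _ => Algebra.TensorProduct.lift_tmul ..

theorem toConv_rightTwist (χ : Λ →ₐ[k] k) :
    toConv (rightTwist χ).toLinearMap = toConv (AlgHom.id k Λ).toLinearMap * convChar Λ χ := by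
  ext a
  have hr := (Coalgebra.Repr.arbitrary k a).convMul_apply
    (toConv (AlgHom.id k Λ).toLinearMap) (convChar Λ χ)
  refine Eq.trans ?_ hr.symm
  change rightTwist χ a = _
  rw [rightTwist, AlgHom.comp_apply, Bialgebra.comulAlgHom_apply,
    ← (Coalgebra.Repr.arbitrary k a).eq]
  rw [map_sum]
  exact Finset.sum_congr rfl fun i _ => Algebra.TensorProduct.lift_tmul ..

variable {B : Type*} [Ring B] [Algebra k B]

theorem toConv_comp_convChar (f : Λ →ₐ[k] B) (χ : Λ →ₐ[k] k) :
    toConv (f.toLinearMap ∘ₗ (convChar Λ χ).ofConv) = convChar B χ := by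
  ext a
  exact f.commutes (χ a)

/-- Composition with an algebra map is multiplicative for convolution and leaves scalar-valued
characters unchanged. -/
theorem toConv_comp_leftTwist (f : Λ →ₐ[k] B) (χ : Λ →ₐ[k] k) :
    toConv (f.comp (leftTwist χ)).toLinearMap = convChar B χ * toConv f.toLinearMap := by
  have h := LinearMap.algHom_comp_convMul_distrib f (convChar Λ χ)
    (toConv (AlgHom.id k Λ).toLinearMap)
  rw [← toConv_leftTwist, toConv_comp_convChar] at h
  exact congrArg toConv h

theorem toConv_comp_rightTwist (f : Λ →ₐ[k] B) (χ : Λ →ₐ[k] k) :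
    toConv (f.comp (rightTwist χ)).toLinearMap = toConv f.toLinearMap * convChar B χ := by
  have h := LinearMap.algHom_comp_convMul_distrib f
    (toConv (AlgHom.id k Λ).toLinearMap) (convChar Λ χ)
  rw [← toConv_rightTwist, toConv_comp_convChar] at h
  exact congrArg toConv h

theorem convChar_self (χ : Λ →ₐ[k] k) : convChar k χ = toConv χ.toLinearMap := rfl

theorem convChar_mul (χ ψ : WithConv (Λ →ₐ[k] k)) :
    convChar B (χ * ψ).ofConv = convChar B χ.ofConv * convChar B ψ.ofConv := by
  have h := LinearMap.algHom_comp_convMul_distrib (Algebra.ofId k B)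
    (toConv χ.ofConv.toLinearMap) (toConv ψ.ofConv.toLinearMap)
  rw [← AlgHom.toLinearMap_convMul] at h
  exact congrArg toConv h

theorem convChar_one : convChar B (1 : WithConv (Λ →ₐ[k] k)).ofConv = 1 := rfl

/-- The left twist reverses products: twisting by `χ` and then by `ψ` is twisting by `χ * ψ`, so the
twist by `χ` is a section. -/
theorem leftTwist_surjective {χ ψ : WithConv (Λ →ₐ[k] k)} (h : χ * ψ = 1) :
    Function.Surjective (leftTwist ψ.ofConv) := by
  have : (leftTwist ψ.ofConv).comp (leftTwist χ.ofConv) = AlgHom.id k Λ := by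
    apply AlgHom.toLinearMap_injective
    apply toConv_injective
    rw [toConv_comp_leftTwist, toConv_leftTwist, ← mul_assoc, ← convChar_mul, h, convChar_one,
      one_mul]
  exact fun a => ⟨leftTwist χ.ofConv a, DFunLike.congr_fun this a⟩

theorem rightTwist_surjective {χ ψ : WithConv (Λ →ₐ[k] k)} (h : χ * ψ = 1) :
    Function.Surjective (rightTwist χ.ofConv) := by
  have : (rightTwist χ.ofConv).comp (rightTwist ψ.ofConv) = AlgHom.id k Λ := by
    apply AlgHom.toLinearMap_injective
    apply toConv_injective
    rw [toConv_comp_rightTwist, toConv_rightTwist, mul_assoc, ← convChar_mul, h, convChar_one,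
      mul_one]
  exact fun a => ⟨rightTwist ψ.ofConv a, DFunLike.congr_fun this a⟩

/-- The algebra endomorphism `a ↦ ∑ χ(a₁) a₂ χ'(a₃)` attached to two characters. -/
def biTwist (χ χ' : WithConv (Λ →ₐ[k] k)) : Λ →ₐ[k] Λ :=
  (rightTwist χ'.ofConv).comp (leftTwist χ.ofConv)

theorem biTwist_surjective {χ χ' : WithConv (Λ →ₐ[k] k)} (h : χ' * χ = 1) :
    Function.Surjective (biTwist χ χ') :=
  (rightTwist_surjective h).comp (leftTwist_surjective h)

/-- When `χ'` is inverse to `χ`, this makes restriction along the twist act on characters by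
conjugation. -/
theorem toConv_comp_biTwist (ψ χ χ' : WithConv (Λ →ₐ[k] k)) :
    toConv (ψ.ofConv.comp (biTwist χ χ')) = χ * ψ * χ' := by
  apply ofConv_injective
  apply AlgHom.toLinearMap_injective
  apply toConv_injective
  rw [AlgHom.toLinearMap_convMul, AlgHom.toLinearMap_convMul, ofConv_toConv, biTwist,
    ← AlgHom.comp_assoc, toConv_comp_leftTwist, toConv_comp_rightTwist, convChar_self,
    convChar_self, mul_assoc]

end Twist

/-! ### Simple classes and their characters -/

section Characters

variable {k Λ : Type u} [Field k] [Ring Λ]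

/-- The algebra `Λ` acts through `χ` on a representative of the class `X`. -/
def IsChar [Algebra k Λ] (X : StructureGroup k Λ) (χ : Λ →ₐ[k] k) : Prop :=
  ∃ M : {M : BundledModule k Λ // IsSimpleModule Λ M},
    Quotient.mk (simpleSetoid k Λ) M = X ∧ HasChar M.1 χ.toLinearMap

theorem IsChar.unique [Algebra k Λ] {X : StructureGroup k Λ} {χ ψ : Λ →ₐ[k] k}
    (h : IsChar X χ) (h' : IsChar X ψ) : χ = ψ := by
  obtain ⟨M, rfl, hM⟩ := h
  obtain ⟨N, hN, hN'⟩ := h'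
  obtain ⟨e⟩ := Quotient.exact hN
  have hM' := hN'.of_equiv e
  have := M.2
  have : Nontrivial M.1 := IsSimpleModule.nontrivial Λ _
  obtain ⟨v, hv⟩ := exists_ne (0 : M.1)
  ext a
  exact smul_left_injective k hv ((hM a v).symm.trans (hM' a v))

variable [HopfAlgebra k Λ] [Module.Finite k Λ] [IsBasic Λ] [IsSplit k Λ]

theorem IsChar.class_eq {X Y : StructureGroup k Λ} {χ : Λ →ₐ[k] k}
    (h : IsChar X χ) (h' : IsChar Y χ) : X = Y := by
  obtain ⟨M, rfl, hM⟩ := h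
  obtain ⟨N, rfl, hN⟩ := h'
  exact Quotient.sound
    (nonempty_equiv_of_hasChar (simple_finrank k M) (simple_finrank k N) hM hN)

theorem exists_isChar (X : StructureGroup k Λ) : ∃ χ : WithConv (Λ →ₐ[k] k), IsChar X χ.ofConv := by
  obtain ⟨M⟩ := X
  obtain ⟨χ, hχ⟩ := simple_hasChar k M
  have := M.2
  have : Nontrivial M.1 := IsSimpleModule.nontrivial Λ _
  exact ⟨toConv (AlgHom.ofLinearMap χ hχ.map_one hχ.map_mul), M, rfl, hχ⟩

theorem IsChar.mul {X Y : StructureGroup k Λ} {χ ψ : WithConv (Λ →ₐ[k] k)}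
    (h : IsChar X χ.ofConv) (h' : IsChar Y ψ.ofConv) : IsChar (X * Y) (χ * ψ).ofConv := by
  obtain ⟨M, rfl, hM⟩ := h
  obtain ⟨N, rfl, hN⟩ := h'
  refine ⟨_, rfl, ?_⟩
  have := hasChar_tensor hM hN
  rwa [← AlgHom.toLinearMap_convMul] at this

theorem isChar_one : IsChar (1 : StructureGroup k Λ) (1 : WithConv (Λ →ₐ[k] k)).ofConv :=
  ⟨_, rfl, hasChar_triv⟩

/-- A class determines its character and the trivial class has character `ε`, so inverses pass from
the structure group to convolution. -/
theorem IsChar.mul_eq_one {X Y : StructureGroup k Λ} {χ ψ : WithConv (Λ →ₐ[k] k)}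
    (h : IsChar X χ.ofConv) (h' : IsChar Y ψ.ofConv) (hXY : X * Y = 1) : χ * ψ = 1 :=
  ofConv_injective ((hXY ▸ h.mul h').unique isChar_one)

end Characters

/-! ### Factors of composition series and their characters -/

section CompositionSums

variable {k Λ : Type u} [Field k] [Ring Λ] [Algebra k Λ] {M : Type u} [AddCommGroup M] [Module k M]
  [Module Λ M] [IsScalarTower k Λ M]

theorem compositionSum_eq_of_equivalent {s t : CompositionSeries (Submodule Λ M)}
    (h : s.Equivalent t) : compositionSum (k := k) s = compositionSum t := by
  obtain ⟨f, hf⟩ := h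
  refine Fintype.sum_equiv f _ _ fun i => ?_
  congr 1
  exact Quotient.sound ⟨(hf i).linearEquiv⟩

/-- Stating the condition inside `M` instead of the quotient lets it be transported along a
semilinear map. -/
theorem isChar_factorClass_iff {A B : Submodule Λ M} (h : A ⋖ B) {χ : Λ →ₐ[k] k} :
    IsChar (factorClass k A B h) χ ↔ ∀ a : Λ, ∀ b ∈ B, a • b - χ a • b ∈ A := by
  have key : HasChar (B ⧸ A.submoduleOf B) χ.toLinearMap ↔
      ∀ a : Λ, ∀ b ∈ B, a • b - χ a • b ∈ A := by
    constructor
    · intro hc a b hb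
      exact (Submodule.Quotient.eq (A.submoduleOf B)).mp
        (hc a (Submodule.Quotient.mk (⟨b, hb⟩ : B)))
    · rintro hc a ⟨b⟩
      exact (Submodule.Quotient.eq (A.submoduleOf B)).mpr (hc a b.1 b.2)
  rw [← key]
  constructor
  · rintro ⟨N, hN, hc⟩
    obtain ⟨e⟩ := Quotient.exact hN
    exact hc.of_equiv e
  · exact fun hc => ⟨_, rfl, hc⟩

end CompositionSums

/-! ### Semilinear self-maps of the projective cover and invariance under conjugation -/

section SemilinearInvariance

variable {k Λ : Type u} [Field k] [Ring Λ]

/-- The module `P` with `Λ` acting through the ring endomorphism `σ`. -/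
def Restricted (_σ : Λ →+* Λ) (P : Type u) : Type u := P

instance (σ : Λ →+* Λ) (P : Type u) [AddCommGroup P] : AddCommGroup (Restricted σ P) :=
  inferInstanceAs (AddCommGroup P)

instance (σ : Λ →+* Λ) (P : Type u) [AddCommGroup P] [Module Λ P] : Module Λ (Restricted σ P) :=
  Module.compHom P σ

section

variable [HopfAlgebra k Λ] {P : Type u} [AddCommGroup P] [Module k P] [Module Λ P]
  [IsScalarTower k Λ P]

theorem map_smul_of_semilinear {σ : Λ →ₐ[k] Λ} (g : P →ₛₗ[(σ : Λ →+* Λ)] P) (c : k) (x : P) :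
    g (c • x) = c • g x := by
  rw [← algebraMap_smul Λ c x, LinearMap.map_smulₛₗ, RingHom.coe_coe, AlgHom.commutes,
    algebraMap_smul]

/-- If `P` is a projective cover of the trivial module, then every surjective algebra endomorphism
`σ` preserving the counit is covered by a bijective `σ`-semilinear endomorphism of `P`. -/
theorem IsProjectiveCover.exists_semilinear [Module.Finite k P]
    {ψ : P →ₗ[Λ] Triv k Λ} (hψ : IsProjectiveCover ψ) (σ : Λ →ₐ[k] Λ)
    [RingHomSurjective (σ : Λ →+* Λ)]
    (hσ : ∀ a, Coalgebra.counit (R := k) (σ a) = Coalgebra.counit (R := k) a) :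
    ∃ g : P →ₛₗ[(σ : Λ →+* Λ)] P, Function.Bijective g := by
  have := hψ.projective
  obtain ⟨g, hg⟩ : ∃ g : P →ₛₗ[(σ : Λ →+* Λ)] P, ∀ x, ψ (g x) = ψ x := by
    -- As `σ` preserves the counit, `ψ` stays linear on `P` restricted along `σ`; a linear lift from
    -- `P` into this restriction is a `σ`-semilinear endomorphism.
    let ψ' : Restricted (σ : Λ →+* Λ) P →ₗ[Λ] Triv k Λ :=
      { toFun := ψ
        map_add' := ψ.map_add
        map_smul' := fun a x => (ψ.map_smul (σ a) x).trans (congrArg (fun c : k => c • ψ x) (hσ a)) }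
    obtain ⟨g, hg⟩ := Module.projective_lifting_property ψ' ψ hψ.surjective
    exact ⟨{ toFun := g, map_add' := g.map_add, map_smul' := g.map_smul },
      DFunLike.congr_fun hg⟩
  have hsurj : Function.Surjective g := by
    rw [← LinearMap.range_eq_top]
    -- The range of `g` is a submodule because `σ` is surjective, and it still maps onto the trivial
    -- module.
    apply hψ.essential
    rw [eq_top_iff]
    intro y _
    obtain ⟨x, rfl⟩ := hψ.surjective y
    exact ⟨g x, ⟨x, rfl⟩, hg x⟩
  -- `σ` fixes scalars, so `g` is `k`-linear, and on a finite dimensional space surjectivity gives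
  -- injectivity.
  let gk : P →ₗ[k] P :=
    { toFun := g, map_add' := g.map_add, map_smul' := map_smul_of_semilinear g }
  exact ⟨g, (LinearMap.injective_iff_surjective (f := gk)).mpr hsurj, hsurj⟩

end

variable [HopfAlgebra k Λ] [Module.Finite k Λ] [IsBasic Λ] [IsSplit k Λ]
variable {M : Type u} [AddCommGroup M] [Module k M] [Module Λ M] [IsScalarTower k Λ M]

/-- If `Λ` acts on `g(B)/g(A)` through `ψ`, then `g(ab) = σ(a) g(b) ≡ ψ(σ(a)) g(b)` modulo `g(A)`.
Injectivity of `g` shows that `Λ` acts on `B/A` through `ψ ∘ σ = χ * ψ * χ'`. -/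
theorem factorClass_map {χ χ' : WithConv (Λ →ₐ[k] k)} {T : StructureGroup k Λ}
    (hT : IsChar T χ.ofConv) (hT' : IsChar T⁻¹ χ'.ofConv)
    [RingHomSurjective (biTwist χ χ' : Λ →+* Λ)]
    (g : M →ₛₗ[(biTwist χ χ' : Λ →+* Λ)] M) (hg : Function.Injective g)
    {A B : Submodule Λ M} (h : A ⋖ B) (h' : A.map g ⋖ B.map g) :
    T * factorClass k (A.map g) (B.map g) h' * T⁻¹ = factorClass k A B h := by
  obtain ⟨ψ, hψ⟩ := exists_isChar (factorClass k (A.map g) (B.map g) h')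
  refine ((hT.mul hψ).mul hT').class_eq ?_
  rw [← toConv_comp_biTwist, ofConv_toConv, isChar_factorClass_iff]
  intro a b hb
  rw [isChar_factorClass_iff] at hψ
  obtain ⟨x, hx, hxe⟩ := hψ (biTwist χ χ' a) (g b) ⟨b, hb, rfl⟩
  have hxb : x = a • b - (ψ.ofConv.comp (biTwist χ χ')) a • b := by
    apply hg
    rw [hxe, map_sub, map_smul_of_semilinear, LinearMap.map_smulₛₗ]
    rfl
  exact hxb ▸ hx

theorem compositionSum_map {χ χ' : WithConv (Λ →ₐ[k] k)} {T : StructureGroup k Λ}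
    (hT : IsChar T χ.ofConv) (hT' : IsChar T⁻¹ χ'.ofConv)
    [RingHomSurjective (biTwist χ χ' : Λ →+* Λ)]
    (g : M →ₛₗ[(biTwist χ χ' : Λ →+* Λ)] M) (hg : Function.Bijective g)
    (s : CompositionSeries (Submodule Λ M)) (hb : s.head = ⊥) (ht : s.last = ⊤) :
    MonoidAlgebra.single T 1 * compositionSum (k := k) s =
      compositionSum s * MonoidAlgebra.single T 1 := by
  let t : CompositionSeries (Submodule Λ M) :=
    { length := s.length
      toFun := fun i => (s i).map g
      step := fun i =>
        (apply_covBy_apply_iff (Submodule.orderIsoMapComapOfBijective g hg)).mpr (s.step i) }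
  have hst : compositionSum (k := k) s = compositionSum t :=
    compositionSum_eq_of_equivalent (CompositionSeries.jordan_holder _ _
      (hb.trans ((congrArg (Submodule.map g) hb).trans (Submodule.map_bot g)).symm)
      (ht.trans ((congrArg (Submodule.map g) ht).trans
        ((Submodule.map_top g).trans (LinearMap.range_eq_top.mpr hg.surjective))).symm))
  rw [hst]
  -- With `t` on the left and `s` on the right, the two sums agree term by term.
  conv_rhs => rw [← hst]
  simp only [compositionSum, Finset.mul_sum, Finset.sum_mul, MonoidAlgebra.single_mul_single,
    mul_one]
  refine Finset.sum_congr rfl fun i _ => ?_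
  rw [← factorClass_map hT hT' g hg.injective (s.step i) (t.step i), inv_mul_cancel_right]

variable (k Λ) in
theorem single_mul_canonicalElement (T : StructureGroup k Λ) :
    MonoidAlgebra.single T 1 * canonicalElement k Λ =
      canonicalElement k Λ * MonoidAlgebra.single T 1 := by
  obtain ⟨χ, hT⟩ := exists_isChar T
  obtain ⟨χ', hT'⟩ := exists_isChar T⁻¹
  have hr : χ * χ' = 1 := hT.mul_eq_one hT' (mul_inv_cancel T)
  have hl : χ' * χ = 1 := hT'.mul_eq_one hT (inv_mul_cancel T)
  have : RingHomSurjective (biTwist χ χ' : Λ →+* Λ) := ⟨biTwist_surjective hl⟩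
  -- The unit of convolution is the counit, so this case says that the twist preserves `ε`.
  have hσ := toConv_comp_biTwist 1 χ χ'
  rw [mul_one, hr] at hσ
  have : Module.Finite k (P₁ k Λ) := Module.Finite.trans Λ (P₁ k Λ)
  obtain ⟨ψ, hψ⟩ := P₁_spec k Λ
  obtain ⟨g, hg⟩ := hψ.exists_semilinear (biTwist χ χ')
    (DFunLike.congr_fun (toConv_injective hσ))
  have hs := (exists_compositionSeries_of_isNoetherian_isArtinian Λ (P₁ k Λ)).choose_spec
  exact compositionSum_map hT hT' g hg _ hs.1 hs.2

end SemilinearInvariance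

end HopfRep

end

theorem mainTheorem9 (k Λ : Type u) [Field k] [Ring Λ] [HopfAlgebra k Λ] [Module.Finite k Λ]
    [HopfRep.IsBasic Λ] [HopfRep.IsSplit k Λ] (hΛ : ¬ IsSemisimpleRing Λ) :
    HopfRep.canonicalElement k Λ ∈
      Subring.center (MonoidAlgebra ℤ (HopfRep.StructureGroup k Λ)) := by
  rw [Subring.mem_center_iff]
  intro x
  induction x using MonoidAlgebra.induction_on with
  | of T => exact HopfRep.single_mul_canonicalElement k Λ T
  | add x y hx hy => rw [add_mul, mul_add, hx, hy]
  | smul r x hx => rw [smul_mul_assoc, mul_smul_comm, hx]
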